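/- Let $G$ be a finite simple undirected graph with $n \ge 1$ vertices. In the (ordinary) toppling game on $G$ there are initially no chips on the vertices, and two players, Max and Min, alternate turns, Max first; on each turn a player places one chip on a vertex of his or her choice. A vertex $v$ may be fired if it holds at least $\deg(v)$ chips; firing it removes $\deg(v)$ chips from $v$ and adds one chip to each neighbour of $v$. After each turn vertices are fired until no vertex may be fired. A configuration of chips is volatile if there is an infinite sequence of vertices that may be fired in order, and the game ends as soon as the configuration is volatile (if the initial configuration is volatile, the game has length $0$). The length of the game is the number of chips placed; Max maximizes and Min minimizes it, and $t(G)$ denotes the length when both play optimally. For a real number $p \in (0,1)$, the fractional toppling game on $G$ is played in the same way (each player still places exactly one chip per turn), except that a vertex $v$ may be fired once it holds at least $p\deg(v)$ chips, and firing it removes $p\deg(v)$ chips from $v$ and adds $p$ chips to each neighbour of $v$; its length when both play optimally and Max plays first is denoted $t_p(G)$. Then $t(G)$ and $t_p(G)$ are finite and $t_p(G) = p\,t(G) + O(n)$. That is, there is an absolute constant $C$ such that for every $n \ge 1$, every $n$-vertex graph $G$ and every $p \in (0,1)$, $$\bigl|t_p(G) - p\,t(G)\bigr| \le C n .$$ 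-/

import Mathlib

/-! ### Chip firing on a finite simple graph

Everything is parametrised by the number type `R` in which chips are counted and by the amount
`q : R` which a firing vertex sends to each neighbour.  Ordinary chip firing is `R = ℕ`, `q = 1`;
the fractional version with parameter `p` is `R = ℝ`, `q = p`. -/

namespace Toppling

/-- The vertex `v` may be fired in the configuration `c`: it holds at least `q * deg v` chips. -/
def CanFire {V : Type*} [Fintype V] {R : Type*} [Semiring R] [LE R]
    (G : SimpleGraph V) [DecidableRel G.Adj] (q : R) (c : V → R) (v : V) : Prop :=
  q * (G.degree v : R) ≤ c v

/-- The configuration after firing `v`: `q * deg v` chips leave `v`, and each neighbour of `v`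
receives `q` chips.  (Only used when `v` may be fired, so the subtraction on `ℕ` is exact.) -/
def fire {V : Type*} [Fintype V] [DecidableEq V] {R : Type*} [Semiring R] [Sub R]
    (G : SimpleGraph V) [DecidableRel G.Adj] (q : R) (c : V → R) (v : V) : V → R :=
  fun w => if w = v then c v - q * (G.degree v : R) else if G.Adj v w then c w + q else c w

/-- `d` arises from `c` by one legal firing. -/
def FiresTo {V : Type*} [Fintype V] [DecidableEq V] {R : Type*} [Semiring R] [Sub R] [LE R]
    (G : SimpleGraph V) [DecidableRel G.Adj] (q : R) (c d : V → R) : Prop :=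
  ∃ v, CanFire G q c v ∧ d = fire G q c v

/-- A configuration is volatile if there is an infinite sequence `v 0, v 1, …` of vertices that may
be fired in order; `s i` is the configuration just before the firing of `v i`. -/
def IsVolatile {V : Type*} [Fintype V] [DecidableEq V] {R : Type*} [Semiring R] [Sub R] [LE R]
    (G : SimpleGraph V) [DecidableRel G.Adj] (q : R) (c : V → R) : Prop :=
  ∃ (v : ℕ → V) (s : ℕ → V → R), s 0 = c ∧
    ∀ i, CanFire G q (s i) (v i) ∧ s (i + 1) = fire G q (s i) (v i)

/-- A configuration is stable if no vertex may be fired. -/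
def IsStable {V : Type*} [Fintype V] {R : Type*} [Semiring R] [LE R]
    (G : SimpleGraph V) [DecidableRel G.Adj] (q : R) (c : V → R) : Prop :=
  ∀ v, ¬ CanFire G q c v

/-- From a configuration that is not volatile, some list of legal firings leads to a stable one. -/
theorem exists_stable_of_not_isVolatile {V : Type*} [Fintype V] [DecidableEq V]
    {R : Type*} [Semiring R] [Sub R] [LE R] (G : SimpleGraph V) [DecidableRel G.Adj]
    (q : R) (c : V → R) (hc : ¬ IsVolatile G q c) :
    ∃ d, Relation.ReflTransGen (FiresTo G q) c d ∧ IsStable G q d := by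
  by_contra hcon
  have h : ∀ d : {d // Relation.ReflTransGen (FiresTo G q) c d}, ∃ v, CanFire G q d.1 v := by
    rintro ⟨d, hd⟩
    by_contra hd2
    exact hcon ⟨d, hd, fun v hv => hd2 ⟨v, hv⟩⟩
  choose f hf using h
  let step : {d // Relation.ReflTransGen (FiresTo G q) c d} →
      {d // Relation.ReflTransGen (FiresTo G q) c d} :=
    fun d => ⟨fire G q d.1 (f d), d.2.tail ⟨f d, hf d, rfl⟩⟩
  let s : ℕ → {d // Relation.ReflTransGen (FiresTo G q) c d} :=
    fun i => Nat.rec ⟨c, Relation.ReflTransGen.refl⟩ (fun _ d => step d) i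
  exact hc ⟨fun i => f (s i), fun i => (s i).1, rfl, fun i => ⟨hf (s i), rfl⟩⟩

open Classical in
/-- Fire vertices until a stable configuration arises; a volatile configuration (at which the game
is over anyway) is left as it is. -/
noncomputable def settle {V : Type*} [Fintype V] [DecidableEq V]
    {R : Type*} [Semiring R] [Sub R] [LE R]
    (G : SimpleGraph V) [DecidableRel G.Adj] (q : R) (c : V → R) : V → R :=
  if hc : IsVolatile G q c then c
  else Classical.choose (exists_stable_of_not_isVolatile G q c hc)

/-! ### The two-player game -/

/-- The two players. -/
inductive Player
  | max
  | min

/-- The configuration after a turn in which a chip is placed on `v`. -/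
noncomputable def afterTurn {V : Type*} [Fintype V] [DecidableEq V]
    {R : Type*} [Semiring R] [Sub R] [LE R]
    (G : SimpleGraph V) [DecidableRel G.Adj] (q : R) (c : V → R) (v : V) : V → R :=
  settle G q (fun w => if w = v then c w + 1 else c w)

/-- `MinCanEndWithin G q k P c`: in the position where the configuration is `c` and it is the turn
of `P`, Min can force the game to end within `k` further turns, whatever Max does.  The game ends
as soon as the configuration is volatile. -/
def MinCanEndWithin {V : Type*} [Fintype V] [DecidableEq V]
    {R : Type*} [Semiring R] [Sub R] [LE R]
    (G : SimpleGraph V) [DecidableRel G.Adj] (q : R) : ℕ → Player → (V → R) → Prop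
  | 0, _, c => IsVolatile G q c
  | k + 1, Player.max, c =>
      IsVolatile G q c ∨ ∀ v, MinCanEndWithin G q k Player.min (afterTurn G q c v)
  | k + 1, Player.min, c =>
      IsVolatile G q c ∨ ∃ v, MinCanEndWithin G q k Player.max (afterTurn G q c v)

/-- The number of turns of the game under optimal play, when Max plays first and there are no chips
initially: the least `k` such that Min can force the game to end within `k` turns (`⊤` if there
is no such `k`). -/
noncomputable def gameLength {V : Type*} [Fintype V] [DecidableEq V]
    {R : Type*} [Semiring R] [Sub R] [LE R]
    (G : SimpleGraph V) [DecidableRel G.Adj] (q : R) : ℕ∞ :=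
  ⨅ (k : ℕ) (_ : MinCanEndWithin G q k Player.max (fun _ => 0)), (k : ℕ∞)

end Toppling

/-- The toppling number of `G`: chips are counted by natural numbers, and a firing vertex sends one
chip to each neighbour. -/
noncomputable def topplingNumber {V : Type*} [Fintype V] [DecidableEq V]
    (G : SimpleGraph V) [DecidableRel G.Adj] : ℕ∞ :=
  Toppling.gameLength G (1 : ℕ)

/-- The length of the fractional toppling game on `G` with parameter `p`: a vertex holding at least
`p * deg v` chips fires, sending `p` chips to each neighbour. -/
noncomputable def fracTopplingNumber {V : Type*} [Fintype V] [DecidableEq V]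
    (G : SimpleGraph V) [DecidableRel G.Adj] (p : ℝ) : ℕ∞ :=
  Toppling.gameLength G p

/-! By the least action principle, a configuration is volatile iff no firing vector brings every
vertex below its threshold (`isVolatile_iff`). This criterion is preserved by legal firings and
monotone in the chips, so the game depends only on how many chips have been placed on each vertex,
and becomes a game in rounds with a monotone goal (`WinsIn`). Dividing by `p` turns the fractional
game into ordinary volatility over the reals with chips of weight `1 / p`.

It remains to compare chips of weights `α` and `β` (`WinsIn.rescale`). Min simulates an `α`-game
while playing the `β`-game: Max's weight is rounded down to whole `α`-chips, and Min's actual chips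
track the simulated replies up to `O(α + β)` per vertex. A final catch-up phase repairs the
accumulated error, of weight `O(n (α + β))`. Applying this in both directions gives the two
inequalities. -/

namespace Toppling

/-! ### Volatility and firing vectors -/

/-- `d` arises from `c` by firing each vertex `v` exactly `u v` times, legally or not. -/
def Toppled {V : Type*} [Fintype V] {R : Type*} [Semiring R]
    (G : SimpleGraph V) [DecidableRel G.Adj] (q : R) (c : V → R) (u : V → ℕ) (d : V → R) : Prop :=
  ∀ w, d w + q * (G.degree w : R) * (u w : R) =
    c w + q * ((∑ x ∈ G.neighborFinset w, u x : ℕ) : R)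

/-- No firing vector `u` brings all vertices of `c` below their firing thresholds. -/
def Unstabilizable {V : Type*} [Fintype V] {R : Type*} [Semiring R] [LE R]
    (G : SimpleGraph V) [DecidableRel G.Adj] (q : R) (c : V → R) : Prop :=
  ∀ u : V → ℕ, ∃ v, q * (G.degree v : R) * ((u v : R) + 1) ≤
    c v + q * ((∑ x ∈ G.neighborFinset v, u x : ℕ) : R)

section Firing

variable {V : Type*} [Fintype V] {R : Type*} [Semiring R]
  {G : SimpleGraph V} [DecidableRel G.Adj] {q : R} {c d e : V → R}

theorem Toppled.refl (c : V → R) : Toppled G q c 0 c := fun w => by simp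

theorem Toppled.trans {u u' : V → ℕ} (h : Toppled G q c u d) (h' : Toppled G q d u' e) :
    Toppled G q c (u + u') e := fun w => by
  have h1 := h w
  have h2 := h' w
  simp only [Pi.add_apply, Finset.sum_add_distrib, Nat.cast_add, mul_add]
  rw [add_comm (q * (G.degree w : R) * (u w : R)), ← add_assoc, h2, add_right_comm, h1, add_assoc]

section Monotone

variable [LinearOrder R] [IsStrictOrderedRing R]

theorem Unstabilizable.mono (h : c ≤ d) (hc : Unstabilizable G q c) : Unstabilizable G q d :=
  fun u => (hc u).imp fun v hv => hv.trans (by gcongr; exact h v)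

/-- A vector `u'` stabilizing `d` would make `u + u'` stabilize `c`. -/
theorem Unstabilizable.of_toppled {u : V → ℕ} (h : Toppled G q c u d)
    (hc : Unstabilizable G q c) : Unstabilizable G q d := by
  intro u'
  obtain ⟨v, hv⟩ := hc (u + u')
  refine ⟨v, ?_⟩
  have h1 := h v
  simp only [Pi.add_apply, Finset.sum_add_distrib, Nat.cast_add, mul_add] at hv ⊢
  rw [← add_assoc (c v), ← h1, add_assoc, add_right_comm, add_assoc,
    add_comm (q * (G.degree v : R) * (u v : R)), ← add_assoc, add_le_add_iff_right] at hv
  exact hv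

end Monotone

variable [LinearOrder R] [Sub R]

theorem Toppled.fire [DecidableEq V] (hsub : ∀ a b : R, b ≤ a → a - b + b = a) {v : V}
    (hv : CanFire G q c v) : Toppled G q c (Pi.single v 1) (fire G q c v) := fun w => by
  have hs : ∑ x ∈ G.neighborFinset w, (Pi.single v 1 : V → ℕ) x = if G.Adj v w then 1 else 0 := by
    simp [G.adj_comm]
  rw [hs, Toppling.fire]
  by_cases hw : w = v
  · subst hw
    simpa using hsub _ _ hv
  · by_cases ha : G.Adj v w <;> simp [hw, ha]

variable [DecidableEq V]

theorem exists_toppled_of_reflTransGen (hsub : ∀ a b : R, b ≤ a → a - b + b = a)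
    (h : Relation.ReflTransGen (FiresTo G q) c d) : ∃ u, Toppled G q c u d := by
  induction h with
  | refl => exact ⟨0, Toppled.refl c⟩
  | tail _ hs ih =>
    obtain ⟨u, hu⟩ := ih
    obtain ⟨v, hv, rfl⟩ := hs
    exact ⟨_, hu.trans (Toppled.fire hsub hv)⟩

theorem IsVolatile.of_firesTo (h : FiresTo G q c d) (hd : IsVolatile G q d) :
    IsVolatile G q c := by
  obtain ⟨v, hv, rfl⟩ := h
  obtain ⟨f, s, h0, hs⟩ := hd
  refine ⟨fun i => Nat.casesOn i v f, fun i => Nat.casesOn i c s, rfl, fun i => ?_⟩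
  cases i with
  | zero => exact ⟨hv, h0⟩
  | succ i => exact hs i

theorem IsVolatile.of_reflTransGen (h : Relation.ReflTransGen (FiresTo G q) c d)
    (hd : IsVolatile G q d) : IsVolatile G q c := by
  induction h with
  | refl => exact hd
  | tail _ hs ih => exact ih (hd.of_firesTo hs)

theorem reflTransGen_settle : Relation.ReflTransGen (FiresTo G q) c (settle G q c) := by
  unfold settle
  split_ifs with h
  · exact .refl
  · exact (Classical.choose_spec (exists_stable_of_not_isVolatile G q c h)).1

variable [IsStrictOrderedRing R]

/-- Least action: if `u` stabilizes `c`, no legal sequence fires a vertex `v` more than `u v` times,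
so every legal sequence is finite. The hypothesis `hsub` treats truncated and true subtraction
alike. -/
theorem IsVolatile.unstabilizable (hsub : ∀ a b : R, b ≤ a → a - b + b = a) (hq : 0 ≤ q)
    (hc : IsVolatile G q c) : Unstabilizable G q c := by
  intro u
  by_contra! hu
  obtain ⟨v, s, h0, hs⟩ := hc
  let f : ℕ → V → ℕ := fun i => ∑ j ∈ Finset.range i, Pi.single (v j) 1
  have hf : ∀ i, Toppled G q c (f i) (s i) := by
    intro i
    induction i with
    | zero => simpa [f, h0] using Toppled.refl c
    | succ i ih =>
      have := ih.trans (Toppled.fire hsub (hs i).1)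
      rw [← (hs i).2] at this
      simpa only [f, Finset.sum_range_succ] using this
  have hle : ∀ i, f i ≤ u := by
    intro i
    induction i with
    | zero => intro w; simp [f]
    | succ i ih =>
      -- Otherwise `v i` has used up its quota while its neighbours are within theirs; completing
      -- `u` would only add chips to `v i`, leaving it fireable.
      have hlt : f i (v i) < u (v i) := by
        by_contra hge
        have heq : f i (v i) = u (v i) := le_antisymm (ih _) (not_lt.1 hge)
        have h1 := hf i (v i)
        have h2 : q * (G.degree (v i) : R) ≤ s i (v i) := (hs i).1
        have h3 : ((∑ x ∈ G.neighborFinset (v i), f i x : ℕ) : R) ≤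
            ((∑ x ∈ G.neighborFinset (v i), u x : ℕ) : R) :=
          Nat.cast_le.2 (Finset.sum_le_sum fun x _ => ih x)
        refine absurd (hu (v i)) (not_lt.2 ?_)
        calc q * (G.degree (v i) : R) * ((u (v i) : R) + 1)
            = q * (G.degree (v i) : R) + q * (G.degree (v i) : R) * (f i (v i) : R) := by
              rw [heq, mul_add, mul_one, add_comm]
          _ ≤ s i (v i) + q * (G.degree (v i) : R) * (f i (v i) : R) := by gcongr
          _ = _ := h1
          _ ≤ _ := by gcongr
      intro w
      have hw : f (i + 1) w = f i w + (Pi.single (v i) 1 : V → ℕ) w := by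
        simp only [f, Finset.sum_range_succ, Pi.add_apply]
      rw [hw]
      by_cases h : w = v i
      · subst h
        simpa using hlt
      · simpa [h] using ih w
  have hsum : ∀ i, ∑ w, f i w = i := by
    intro i
    simp only [f, Finset.sum_apply]
    rw [Finset.sum_comm]
    simp
  have := Finset.sum_le_sum fun w (_ : w ∈ Finset.univ) => hle (∑ w, u w + 1) w
  rw [hsum] at this
  omega

theorem Unstabilizable.isVolatile (hsub : ∀ a b : R, b ≤ a → a - b + b = a)
    (hc : Unstabilizable G q c) : IsVolatile G q c := by
  by_contra h
  obtain ⟨d, hd, hst⟩ := exists_stable_of_not_isVolatile G q c h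
  obtain ⟨u, hu⟩ := exists_toppled_of_reflTransGen hsub hd
  obtain ⟨v, hv⟩ := hc u
  rw [← hu v, mul_add, mul_one, add_comm, add_le_add_iff_right] at hv
  exact hst v hv

theorem isVolatile_iff (hsub : ∀ a b : R, b ≤ a → a - b + b = a) (hq : 0 ≤ q) :
    IsVolatile G q c ↔ Unstabilizable G q c :=
  ⟨fun h => h.unstabilizable hsub hq, fun h => h.isVolatile hsub⟩

theorem isVolatile_iff_of_reflTransGen (hsub : ∀ a b : R, b ≤ a → a - b + b = a) (hq : 0 ≤ q)
    (h : Relation.ReflTransGen (FiresTo G q) c d) : IsVolatile G q d ↔ IsVolatile G q c := by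
  refine ⟨IsVolatile.of_reflTransGen h, fun hc => ?_⟩
  obtain ⟨u, hu⟩ := exists_toppled_of_reflTransGen hsub h
  exact ((hc.unstabilizable hsub hq).of_toppled hu).isVolatile hsub

theorem FiresTo.add_right (hsub : ∀ a b : R, b ≤ a → a - b + b = a)
    (he : 0 ≤ e) (h : FiresTo G q c d) : FiresTo G q (c + e) (d + e) := by
  obtain ⟨v, hv, rfl⟩ := h
  have hv' : CanFire G q (c + e) v := le_add_of_le_of_nonneg hv (he v)
  refine ⟨v, hv', ?_⟩
  funext w
  by_cases hw : w = v
  · subst hw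
    have h1 := hsub _ _ hv
    have h2 := hsub _ _ hv'
    refine add_right_cancel (b := q * (G.degree w : R)) ?_
    simp only [fire, if_true, Pi.add_apply] at h2 ⊢
    rw [h2, add_right_comm, h1]
  · by_cases ha : G.Adj v w <;> simp [fire, hw, ha, add_right_comm]

theorem reflTransGen_add_right (hsub : ∀ a b : R, b ≤ a → a - b + b = a)
    (he : 0 ≤ e) (h : Relation.ReflTransGen (FiresTo G q) c d) :
    Relation.ReflTransGen (FiresTo G q) (c + e) (d + e) := by
  induction h with
  | refl => exact .refl
  | tail _ hs ih => exact ih.tail (hs.add_right hsub he)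

theorem reflTransGen_afterTurn (hsub : ∀ a b : R, b ≤ a → a - b + b = a) {k : V → ℕ}
    (h : Relation.ReflTransGen (FiresTo G q) (fun w => (k w : R)) d) (v : V) :
    Relation.ReflTransGen (FiresTo G q) (fun w => ((k + Pi.single v 1 : V → ℕ) w : R))
      (afterTurn G q d v) := by
  have he : (0 : V → R) ≤ Pi.single v 1 := by simp
  have h1 := reflTransGen_add_right hsub he h
  have h2 : (fun w => ((k + Pi.single v 1 : V → ℕ) w : R)) = (fun w => (k w : R)) + Pi.single v 1 := by
    funext w
    by_cases hw : w = v
    · subst hw; simp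
    · simp [hw]
  have h3 : (fun w => if w = v then d w + 1 else d w) = d + Pi.single v 1 := by
    funext w
    by_cases hw : w = v
    · subst hw; simp
    · simp [hw]
  rw [afterTurn, h2, h3]
  exact h1.trans reflTransGen_settle

end Firing

/-! ### The game in rounds -/

/-- Both players alternately add a unit to a coordinate of `k`, Max first. Min can ensure that
`F` holds after `J` rounds of one move each. -/
def WinsIn {V : Type*} [DecidableEq V] (F : (V → ℕ) → Prop) : ℕ → (V → ℕ) → Prop
  | 0, k => F k
  | J + 1, k => ∀ v, ∃ w, WinsIn F J (k + Pi.single v 1 + Pi.single w 1)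

section Rounds

variable {V : Type*} [DecidableEq V] {F : (V → ℕ) → Prop}

theorem WinsIn.of_le [Nonempty V] (hF : ∀ k k', k ≤ k' → F k → F k') {J : ℕ} {k k' : V → ℕ}
    (hk : k ≤ k') (h : F k) : WinsIn F J k' := by
  induction J generalizing k' with
  | zero => exact hF _ _ hk h
  | succ J ih =>
    intro v
    exact ⟨v, ih (hk.trans (by rw [add_assoc]; exact le_self_add))⟩

theorem WinsIn.exists_reply [Nonempty V] (hF : ∀ k k', k ≤ k' → F k → F k') {J : ℕ} {k : V → ℕ}
    (h : WinsIn F J k) (v : V) : ∃ w, WinsIn F (J - 1) (k + Pi.single v 1 + Pi.single w 1) := by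
  cases J with
  | zero => exact ⟨v, WinsIn.of_le hF (by rw [add_assoc]; exact le_self_add) h⟩
  | succ J => exact h v

/-- One chip of Max in the `β`-game may amount to `m` simulated `α`-chips on the same vertex, or to
none. Truncation in `J - m` is harmless: once the goal holds, it persists. -/
theorem WinsIn.exists_replies [Fintype V] [Nonempty V] (hF : ∀ k k', k ≤ k' → F k → F k')
    {J : ℕ} {k : V → ℕ} (h : WinsIn F J k) (v : V) (m : ℕ) :
    ∃ d : V → ℕ, ∑ w, d w = m ∧ WinsIn F (J - m) (k + Pi.single v m + d) := by
  induction m with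
  | zero => exact ⟨0, by simp, by rwa [Nat.sub_zero, Pi.single_zero, add_zero, add_zero]⟩
  | succ m ih =>
    obtain ⟨d, hd, hw⟩ := ih
    obtain ⟨w, hw⟩ := hw.exists_reply hF v
    refine ⟨d + Pi.single w 1, by simp [Finset.sum_add_distrib, hd], ?_⟩
    have : k + Pi.single v (m + 1) + (d + Pi.single w 1) =
        k + Pi.single v m + d + Pi.single v 1 + Pi.single w 1 := by
      rw [Pi.single_add]; abel
    rw [this]
    exact hw

/-- Min places the missing chips `d` one per round; Max's chips cannot hurt, by monotonicity. -/
theorem WinsIn.of_catch_up [Fintype V] [Nonempty V] (hF : ∀ k k', k ≤ k' → F k → F k') {J : ℕ}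
    {k d : V → ℕ} (hd : ∑ w, d w ≤ J) (h : F (k + d)) : WinsIn F J k := by
  induction J generalizing k d with
  | zero =>
    have : d = 0 := by
      funext w
      have := Finset.single_le_sum (f := d) (fun _ _ => Nat.zero_le _) (Finset.mem_univ w)
      simp only [Pi.zero_apply]
      omega
    rwa [this, add_zero] at h
  | succ J ih =>
    intro v
    by_cases h0 : d = 0
    · subst h0
      refine ⟨v, WinsIn.of_le hF ?_ h⟩
      rw [add_zero, add_assoc]
      exact le_self_add
    · obtain ⟨w, hw⟩ : ∃ w, d w ≠ 0 := by
        by_contra! hcon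
        exact h0 (funext hcon)
      have hle : (Pi.single w 1 : V → ℕ) ≤ d := by
        intro x
        by_cases hx : x = w
        · subst hx; simpa using Nat.one_le_iff_ne_zero.2 hw
        · simp [hx]
      obtain ⟨d', rfl⟩ := exists_add_of_le hle
      refine ⟨w, ih (d := d') ?_ (hF _ _ ?_ h)⟩
      · simp [Finset.sum_add_distrib] at hd
        omega
      · intro x
        simp only [Pi.add_apply]
        omega

end Rounds

/-! ### The toppling game as a game in rounds -/

section Equivalence

variable {V : Type*} [Fintype V] [DecidableEq V] {R : Type*} [Semiring R] [LinearOrder R]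
  [Sub R] {G : SimpleGraph V} [DecidableRel G.Adj] {q : R}

theorem MinCanEndWithin.succ {k : ℕ} {P : Player} {c : V → R} (h : MinCanEndWithin G q k P c) :
    MinCanEndWithin G q (k + 1) P c := by
  induction k generalizing P c with
  | zero => cases P <;> exact Or.inl h
  | succ k ih =>
    cases P with
    | max => exact h.imp_right fun h v => ih (h v)
    | min => exact h.imp_right fun ⟨v, h⟩ => ⟨v, ih h⟩

theorem gameLength_eq_find (h : ∃ k, MinCanEndWithin G q k Player.max fun _ => 0) :
    ∃ t : ℕ, gameLength G q = t ∧ MinCanEndWithin G q t Player.max (fun _ => 0) ∧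
      ∀ k, MinCanEndWithin G q k Player.max (fun _ => 0) → t ≤ k := by
  classical
  refine ⟨Nat.find h, le_antisymm ?_ ?_, Nat.find_spec h, fun k => Nat.find_min' h⟩
  · exact iInf₂_le (Nat.find h) (Nat.find_spec h)
  · exact le_iInf₂ fun k hk => Nat.cast_le.2 (Nat.find_min' h hk)

variable [IsStrictOrderedRing R]

/-- Here `k` records all chips placed and `c` is what legal firing has made of them; both have the
same volatility. If the game ends early, monotonicity lets idle moves fill the remaining rounds. -/
theorem minCanEndWithin_two_mul_iff [Nonempty V] (hsub : ∀ a b : R, b ≤ a → a - b + b = a)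
    (hq : 0 ≤ q) {J : ℕ} {k : V → ℕ} {c : V → R}
    (h : Relation.ReflTransGen (FiresTo G q) (fun w => (k w : R)) c) :
    MinCanEndWithin G q (2 * J) Player.max c ↔
      WinsIn (fun k => Unstabilizable G q fun w => (k w : R)) J k := by
  have hF : ∀ k k' : V → ℕ, k ≤ k' → Unstabilizable G q (fun w => (k w : R)) →
      Unstabilizable G q (fun w => (k' w : R)) :=
    fun k k' hk h => h.mono fun w => Nat.cast_le.2 (hk w)
  have hvol : ∀ {k : V → ℕ} {c : V → R},
      Relation.ReflTransGen (FiresTo G q) (fun w => (k w : R)) c →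
      (IsVolatile G q c ↔ Unstabilizable G q fun w => (k w : R)) := fun h =>
    (isVolatile_iff_of_reflTransGen hsub hq h).trans (isVolatile_iff hsub hq)
  induction J generalizing k c with
  | zero => exact hvol h
  | succ J ih =>
    change (IsVolatile G q c ∨ ∀ v, (IsVolatile G q _ ∨
      ∃ w, MinCanEndWithin G q (2 * J) Player.max _)) ↔ ∀ v, ∃ w, WinsIn _ J _
    constructor
    · rintro (hc | hc) v
      · exact ⟨v, WinsIn.of_le hF (by rw [add_assoc]; exact le_self_add) ((hvol h).1 hc)⟩
      · have hv := reflTransGen_afterTurn hsub h v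
        obtain hc | ⟨w, hw⟩ := hc v
        · exact ⟨v, WinsIn.of_le hF le_self_add ((hvol hv).1 hc)⟩
        · exact ⟨w, (ih (reflTransGen_afterTurn hsub hv w)).1 hw⟩
    · intro hc
      refine Or.inr fun v => Or.inr ?_
      obtain ⟨w, hw⟩ := hc v
      exact ⟨w, (ih (reflTransGen_afterTurn hsub (reflTransGen_afterTurn hsub h v) w)).2 hw⟩

theorem gameLength_rounds [Nonempty V] (hsub : ∀ a b : R, b ≤ a → a - b + b = a)
    (hq : 0 ≤ q) {J : ℕ}
    (hJ : WinsIn (fun k => Unstabilizable G q fun w => (k w : R)) J 0) :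
    ∃ t J' : ℕ, gameLength G q = t ∧ 2 * J' ≤ t + 1 ∧
      WinsIn (fun k => Unstabilizable G q fun w => (k w : R)) J' 0 ∧
      ∀ K, WinsIn (fun k => Unstabilizable G q fun w => (k w : R)) K 0 → t ≤ 2 * K := by
  have key : ∀ {J}, MinCanEndWithin G q (2 * J) Player.max (fun _ => 0) ↔
      WinsIn (fun k => Unstabilizable G q fun w => (k w : R)) J 0 :=
    minCanEndWithin_two_mul_iff hsub hq (by simpa using Relation.ReflTransGen.refl)
  obtain ⟨t, ht, hw, hmin⟩ := gameLength_eq_find ⟨_, key.2 hJ⟩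
  -- An odd `t` is rounded up to a full round.
  refine ⟨t, (t + 1) / 2, ht, by omega, key.1 ?_, fun K hK => hmin _ (key.2 hK)⟩
  obtain h | h : 2 * ((t + 1) / 2) = t ∨ 2 * ((t + 1) / 2) = t + 1 := by omega
  · rwa [h]
  · rw [h]; exact hw.succ

end Equivalence

/-! ### Changing the weight of a chip -/

section Scaling

variable {V : Type*} [Fintype V] [DecidableEq V] [Nonempty V]

/-- Invariant of the simulation: `x` and `y` are the actual chips of Max and Min, the floors and `z`
their simulated counterparts. Of the `N` simulation rounds `r` remain; `K` further rounds are
reserved for catching up. -/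
theorem WinsIn.rescale_aux {F : (V → ℝ) → Prop} (hF : ∀ c c', c ≤ c' → F c → F c') {α β : ℝ}
    (hα : 0 < α) (hβ : 0 < β) {J N K : ℕ}
    (hN : (J + Fintype.card V) * α ≤ N * β)
    (hK : Fintype.card V * (α + 2 * β) ≤ K * β) (r : ℕ) (x y z : V → ℕ)
    (hr : ∑ v, x v + r = N) (hxy : ∑ v, y v = ∑ v, x v)
    (hz : ∑ v, z v = ∑ v, ⌊β * x v / α⌋₊) (hb : ∀ v, -(α + β) ≤ α * z v - β * y v)
    (hw : WinsIn (fun k => F fun v => α * k v) (J - ∑ v, ⌊β * x v / α⌋₊)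
      ((fun v => ⌊β * x v / α⌋₊) + z)) :
    WinsIn (fun k => F fun v => β * k v) (r + K) (x + y) := by
  have hFα : ∀ k k' : V → ℕ, k ≤ k' → F (fun v => α * k v) → F (fun v => α * k' v) :=
    fun k k' hk => hF _ _ fun v => by
      have : (k v : ℝ) ≤ k' v := Nat.cast_le.2 (hk v)
      dsimp only; gcongr
  have hFβ : ∀ k k' : V → ℕ, k ≤ k' → F (fun v => β * k v) → F (fun v => β * k' v) :=
    fun k k' hk => hF _ _ fun v => by
      have : (k v : ℝ) ≤ k' v := Nat.cast_le.2 (hk v)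
      dsimp only; gcongr
  have hfl : ∀ n : ℕ, α * ⌊β * n / α⌋₊ ≤ β * n := fun n => by
    have := Nat.floor_le (a := β * n / α) (by positivity)
    rwa [le_div_iff₀ hα, mul_comm] at this
  have hfl' : ∀ n : ℕ, β * n ≤ α * ⌊β * n / α⌋₊ + α := fun n => by
    have := (Nat.lt_floor_add_one (β * n / α)).le
    rw [div_le_iff₀ hα] at this
    linarith
  have hsum : ∀ x : V → ℕ, β * ∑ v, (x v : ℝ) ≤
      α * ∑ v, (⌊β * x v / α⌋₊ : ℝ) + Fintype.card V * α := fun x => by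
    have := Finset.sum_le_sum fun v (_ : v ∈ Finset.univ) => hfl' (x v)
    simpa [Finset.sum_add_distrib, ← Finset.mul_sum] using this
  have hsum' : ∀ x : V → ℕ, α * ∑ v, (⌊β * x v / α⌋₊ : ℝ) ≤ β * ∑ v, (x v : ℝ) := fun x => by
    have := Finset.sum_le_sum fun v (_ : v ∈ Finset.univ) => hfl (x v)
    simpa [← Finset.mul_sum] using this
  induction r generalizing x y z with
  | zero =>
    have hz' : ∑ v, (z v : ℝ) = ∑ v, (⌊β * x v / α⌋₊ : ℝ) := by exact_mod_cast hz
    have hxy' : ∑ v, (y v : ℝ) = ∑ v, (x v : ℝ) := by exact_mod_cast hxy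
    have hr' : ∑ v, (x v : ℝ) = N := by exact_mod_cast hr
    -- Rounding loses less than `α` per vertex, so `N` rounds exhaust all `J` simulated ones.
    have hJ : J - ∑ v, ⌊β * x v / α⌋₊ = 0 := by
      have h1 := hsum x
      rw [hr'] at h1
      have h2 : α * J ≤ α * ∑ v, (⌊β * x v / α⌋₊ : ℝ) := by linarith
      have h3 := le_of_mul_le_mul_left h2 hα
      exact Nat.sub_eq_zero_of_le (by exact_mod_cast h3)
    rw [hJ] at hw
    rw [zero_add]
    -- Min fills in each positive deficit of `β * y` against `α * z`. The signed deficits sum to at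
    -- most `0` and each is at least `-(α + β)`; with `β` per ceiling this costs at most `n (α +
    -- 2β)`.
    refine WinsIn.of_catch_up hFβ (d := fun v => ⌈(α * z v - β * y v) / β⌉₊) ?_ (hF _ _ ?_ hw)
    · have hd : ∀ v, β * ⌈(α * z v - β * y v) / β⌉₊ ≤ α * z v - β * y v + (α + β) + β := by
        intro v
        have hle : (⌈(α * z v - β * y v) / β⌉₊ : ℝ) ≤
            (α * z v - β * y v + (α + β)) / β + 1 := by
          refine (Nat.cast_le.2 (Nat.ceil_mono ?_)).trans
            (Nat.ceil_lt_add_one (div_nonneg (by linarith [hb v]) hβ.le)).le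
          gcongr
          linarith
        calc β * ⌈(α * z v - β * y v) / β⌉₊ ≤
            β * ((α * z v - β * y v + (α + β)) / β + 1) := by gcongr
          _ = _ := by field_simp
      have h1 := Finset.sum_le_sum fun v (_ : v ∈ Finset.univ) => hd v
      simp only [Finset.sum_add_distrib, Finset.sum_sub_distrib, ← Finset.mul_sum,
        Finset.sum_const, Finset.card_univ, nsmul_eq_mul] at h1
      have h2 := hsum' x
      rw [hz', hxy'] at h1
      have h3 : β * ∑ v, (⌈(α * z v - β * y v) / β⌉₊ : ℝ) ≤ β * K := by linarith
      exact_mod_cast le_of_mul_le_mul_left h3 hβ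
    · intro v
      have h1 := hfl (x v)
      have h2 := Nat.le_ceil ((α * z v - β * y v) / β)
      rw [div_le_iff₀ hβ] at h2
      simp only [Pi.add_apply, Nat.cast_add, mul_add]
      linarith
  | succ r ih =>
    rw [Nat.add_right_comm]
    intro v
    set m := ⌊β * ((x v + 1 : ℕ) : ℝ) / α⌋₊ - ⌊β * x v / α⌋₊ with hm
    have hfm : ⌊β * ((x v + 1 : ℕ) : ℝ) / α⌋₊ = ⌊β * x v / α⌋₊ + m := by
      have : ⌊β * x v / α⌋₊ ≤ ⌊β * ((x v + 1 : ℕ) : ℝ) / α⌋₊ := by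
        apply Nat.floor_mono
        gcongr
        omega
      omega
    obtain ⟨d, hd, hwd⟩ := hw.exists_replies hFα v m
    have hx' : (fun w => ⌊β * ((x + Pi.single v 1 : V → ℕ) w : ℕ) / α⌋₊) =
        (fun w => ⌊β * x w / α⌋₊) + Pi.single v m := by
      funext w
      by_cases h : w = v
      · subst h
        simpa using hfm
      · simp [h]
    have hxs : ∑ w, ⌊β * ((x + Pi.single v 1 : V → ℕ) w : ℕ) / α⌋₊ = ∑ w, ⌊β * x w / α⌋₊ + m := by
      rw [hx']
      simp [Finset.sum_add_distrib]
    have hxs1 : ∑ w, (x + Pi.single v 1 : V → ℕ) w = ∑ w, x w + 1 := by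
      simp [Finset.sum_add_distrib]
    have hz' : ∑ w, (z + d) w = ∑ w, ⌊β * ((x + Pi.single v 1 : V → ℕ) w : ℕ) / α⌋₊ := by
      rw [hxs, ← hz, ← hd]
      simp [Finset.sum_add_distrib]
    -- Averaging: the total of `α * (z + d) - β * y` is at least `β - nα`. A chip on this `w` costs
    -- `β` and keeps the bound `-(α + β)`.
    obtain ⟨w, hwb⟩ : ∃ w, -α ≤ α * ((z + d) w : ℕ) - β * y w := by
      by_contra! hcon
      have h1 := Finset.sum_lt_sum_of_nonempty Finset.univ_nonempty
        fun w (_ : w ∈ Finset.univ) => hcon w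
      simp only [Finset.sum_sub_distrib, ← Finset.mul_sum, Finset.sum_const, Finset.card_univ,
        nsmul_eq_mul] at h1
      have h2 := hsum (x + Pi.single v 1)
      have h3 : ∑ w, (((z + d) w : ℕ) : ℝ) =
          ∑ w, (⌊β * ((x + Pi.single v 1 : V → ℕ) w : ℕ) / α⌋₊ : ℝ) := by exact_mod_cast hz'
      have h4 : ∑ w, (((x + Pi.single v 1 : V → ℕ) w : ℕ) : ℝ) = ∑ w, (y w : ℝ) + 1 := by
        exact_mod_cast hxs1.trans (by rw [hxy])
      rw [h3] at h1
      rw [h4] at h2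
      linarith
    refine ⟨w, ?_⟩
    have := ih (x + Pi.single v 1) (y + Pi.single w 1) (z + d) (by omega)
      (by rw [hxs1, ← hxy]; simp [Finset.sum_add_distrib]) hz' ?_ ?_
    · have he : x + y + Pi.single v 1 + Pi.single w 1 =
          x + Pi.single v 1 + (y + Pi.single w 1) := by abel
      rwa [he]
    · intro u
      by_cases h : u = w
      · subst h
        simp only [Pi.add_apply, Pi.single_eq_same, Nat.cast_add, Nat.cast_one] at hwb ⊢
        linarith
      · have h1 := hb u
        have h2 : 0 ≤ α * (d u : ℝ) := by positivity
        simp only [Pi.add_apply, Pi.single_eq_of_ne h, Nat.cast_add, Nat.cast_zero]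
        linarith
    · rw [hxs, hx', ← Nat.sub_sub]
      have he : (fun w => ⌊β * x w / α⌋₊) + Pi.single v m + (z + d) =
          (fun w => ⌊β * x w / α⌋₊) + z + Pi.single v m + d := by abel
      rwa [he]

/-- If Min wins in `J` rounds with chips of weight `α`, then Min can win with chips of weight `β`
while the total weight placed grows only by `O(α + β)` per vertex. -/
theorem WinsIn.rescale {F : (V → ℝ) → Prop} (hF : ∀ c c', c ≤ c' → F c → F c') {α β : ℝ}
    (hα : 0 < α) (hβ : 0 < β) {J : ℕ} (h : WinsIn (fun k => F fun v => α * k v) J 0) :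
    ∃ K : ℕ, K * β ≤ J * α + Fintype.card V * (2 * α + 4 * β) ∧
      WinsIn (fun k => F fun v => β * k v) K 0 := by
  have hn : (1 : ℝ) ≤ Fintype.card V := Nat.one_le_cast.2 Fintype.card_pos
  set n : ℝ := (Fintype.card V : ℝ)
  refine ⟨⌈(J + n) * α / β⌉₊ + ⌈n * (α + 2 * β) / β⌉₊, ?_, ?_⟩
  · have h1 := (Nat.ceil_lt_add_one (show 0 ≤ (J + n) * α / β by positivity)).le
    have h2 := (Nat.ceil_lt_add_one (show 0 ≤ n * (α + 2 * β) / β by positivity)).le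
    rw [Nat.cast_add]
    calc _ ≤ ((J + n) * α / β + 1 + (n * (α + 2 * β) / β + 1)) * β := by gcongr
      _ = J * α + n * (2 * α + 2 * β) + 2 * 1 * β := by field_simp; ring
      _ ≤ J * α + n * (2 * α + 2 * β) + 2 * n * β := by gcongr
      _ = _ := by ring
  · have := WinsIn.rescale_aux hF hα hβ (J := J) (N := ⌈(J + n) * α / β⌉₊)
      (K := ⌈n * (α + 2 * β) / β⌉₊) ((div_le_iff₀ hβ).1 (Nat.le_ceil _))
      ((div_le_iff₀ hβ).1 (Nat.le_ceil _)) ⌈(J + n) * α / β⌉₊ 0 0 0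
      (by simp) (by simp) (by simp) (fun v => by simp; linarith) (by
        have he : ((fun v : V => ⌊β * ((0 : V → ℕ) v : ℝ) / α⌋₊) + 0) = 0 := by
          funext v; simp
        rw [he]
        simpa using h)
    simpa using this

end Scaling

/-! ### Weighted chips and termination -/

section Weights

variable {V : Type*} [Fintype V] {G : SimpleGraph V} [DecidableRel G.Adj]

theorem unstabilizable_smul_iff {p : ℝ} (hp : 0 < p) {c : V → ℝ} :
    Unstabilizable G p c ↔ Unstabilizable G (1 : ℝ) fun v => 1 / p * c v := by
  refine forall_congr' fun u => exists_congr fun v => ?_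
  rw [← mul_le_mul_iff_right₀ (show 0 < 1 / p by positivity)]
  field_simp

theorem unstabilizable_cast_iff {k : V → ℕ} :
    Unstabilizable G (1 : ℕ) (fun v => (Nat.cast (k v) : ℕ)) ↔
      Unstabilizable G (1 : ℝ) fun v => 1 * (k v : ℝ) := by
  refine forall_congr' fun u => exists_congr fun v => ?_
  rw [← Nat.cast_le (α := ℝ)]
  push_cast
  simp

/-- Firing preserves the total, whereas being below threshold everywhere forces a total less than
the sum of degrees. -/
theorem unstabilizable_of_sum_degree_le [Nonempty V] {k : V → ℕ}
    (hk : ∑ v, G.degree v ≤ ∑ v, k v) : Unstabilizable G (1 : ℕ) (fun v => (Nat.cast (k v) : ℕ)) := by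
  intro u
  by_contra! hcon
  have h := Finset.sum_lt_sum_of_nonempty Finset.univ_nonempty
    fun v (_ : v ∈ Finset.univ) => hcon v
  have hs : ∑ v, ∑ x ∈ G.neighborFinset v, u x = ∑ v, G.degree v * u v := by
    simp only [SimpleGraph.neighborFinset_eq_filter, Finset.sum_filter]
    rw [Finset.sum_comm]
    refine Finset.sum_congr rfl fun x _ => ?_
    simp only [G.adj_comm _ x]
    rw [← Finset.sum_filter, Finset.sum_const, smul_eq_mul, ← SimpleGraph.neighborFinset_eq_filter,
      SimpleGraph.card_neighborFinset_eq_degree]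
  simp only [one_mul, Nat.cast_id, mul_add, mul_one, Finset.sum_add_distrib, hs] at h
  omega

end Weights

end Toppling

/-! ### The two bounds combined -/

open Toppling in
theorem theorem9 :
    ∃ C : ℝ, ∀ (V : Type*) [Fintype V] [DecidableEq V] [Nonempty V]
      (G : SimpleGraph V) [DecidableRel G.Adj] (p : ℝ), 0 < p → p < 1 →
      ∃ t tp : ℕ, topplingNumber G = (t : ℕ∞) ∧ fracTopplingNumber G p = (tp : ℕ∞) ∧
        |(tp : ℝ) - p * (t : ℝ)| ≤ C * (Fintype.card V : ℝ) := by
  -- Doubling the rescaling error `n (2p + 4)` or `n (2 + 4p)` gives at most `12 n`; rounding to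
  -- full rounds adds at most `1 ≤ n`.
  refine ⟨13, fun V _ _ _ G _ p hp hp1 => ?_⟩
  have hn : (1 : ℝ) ≤ Fintype.card V := Nat.one_le_cast.2 Fintype.card_pos
  have hF : ∀ c c' : V → ℝ, c ≤ c' → Unstabilizable G (1 : ℝ) c → Unstabilizable G (1 : ℝ) c' :=
    fun c c' h hc => hc.mono h
  have hord : (fun k : V → ℕ => Unstabilizable G (1 : ℕ) fun v => (Nat.cast (k v) : ℕ)) =
      fun k => Unstabilizable G (1 : ℝ) fun v => 1 * (k v : ℝ) :=
    funext fun k => propext unstabilizable_cast_iff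
  have hfrac : (fun k : V → ℕ => Unstabilizable G p fun v => (k v : ℝ)) =
      fun k => Unstabilizable G (1 : ℝ) fun v => 1 / p * (k v : ℝ) :=
    funext fun k => propext (unstabilizable_smul_iff hp)
  -- Min alone can put `deg v` chips on each `v`.
  have hfin : WinsIn (fun k : V → ℕ => Unstabilizable G (1 : ℕ) fun v => (Nat.cast (k v) : ℕ))
      (∑ v, G.degree v) 0 :=
    WinsIn.of_catch_up (fun k k' hk h => h.mono hk) (d := fun v => G.degree v) le_rfl
      (unstabilizable_of_sum_degree_le (by simp))
  obtain ⟨t, J, ht, hJt, hJ, hmin⟩ := gameLength_rounds (R := ℕ)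
    (fun a b => Nat.sub_add_cancel) zero_le_one hfin
  rw [hord] at hJ hmin
  obtain ⟨K, hK, hKw⟩ := hJ.rescale hF one_pos (one_div_pos.2 hp)
  rw [← hfrac] at hKw
  obtain ⟨tp, J', htp, hJtp, hJ', hminp⟩ := gameLength_rounds (R := ℝ)
    (fun a b _ => sub_add_cancel a b) hp.le hKw
  have h1 := hminp K hKw
  rw [hfrac] at hJ'
  obtain ⟨K', hK', hKw'⟩ := hJ'.rescale hF (one_div_pos.2 hp) one_pos
  have h2 := hmin K' hKw'
  refine ⟨t, tp, ht, htp, ?_⟩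
  set n : ℝ := (Fintype.card V : ℝ)
  have hJt' : 2 * (J : ℝ) ≤ t + 1 := by exact_mod_cast hJt
  have hJtp' : 2 * (J' : ℝ) ≤ tp + 1 := by exact_mod_cast hJtp
  have h1' : (tp : ℝ) ≤ 2 * K := by exact_mod_cast h1
  have h2' : (t : ℝ) ≤ 2 * K' := by exact_mod_cast h2
  have hK1 : (K : ℝ) ≤ p * J + n * (2 * p + 4) := by
    have := mul_le_mul_of_nonneg_left hK hp.le
    field_simp at this
    linarith
  have hK1' : p * (K' : ℝ) ≤ J' + n * (2 + 4 * p) := by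
    have := mul_le_mul_of_nonneg_left hK' hp.le
    field_simp at this
    linarith
  have hpn : p * n ≤ 1 * n := by gcongr
  have hpJ := mul_le_mul_of_nonneg_left hJt' hp.le
  have hpt := mul_le_mul_of_nonneg_left h2' hp.le
  rw [abs_le]
  constructor <;> linarith
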